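/- \textbf{Theorem (Equivalent sets of MUBs).} Let $m\ge 1$, $d=2^m$, and let $\mathbb C^d=(\mathbb C^2)^{\otimes m}$ have standard basis $|l\rangle$, $l\in\mathbb F_2^m$. For $a=(a_z\,|\,a_x)\in\mathbb F_2^{2m}$ let $XZ(a)=i^{\sum_k a^{(x)}_k a^{(z)}_k}\,\bigotimes_{k=1}^m X^{a^{(x)}_k}Z^{a^{(z)}_k}$, with $X|i\rangle=|i+1\rangle$, $Z|i\rangle=(-1)^i|i\rangle$ for $i\in\mathbb F_2$. A matrix $G\in\mathbb F_2^{2m\times m}$ generates the class $\{XZ(Gc): 0\ne c\in\mathbb F_2^m\}$. An eigenbasis of a class is a unitary matrix whose columns are common eigenvectors of all operators in the class. Two families $(\mathcal B_k)_{k=0}^d$, $(\mathcal B'_k)_{k=0}^d$ of orthonormal bases, written as unitary matrices, are equivalent if $\mathcal B'_k=U\mathcal B_{\pi(k)}W_k$ for all $k$, with a unitary $U$, a permutation $\pi$ of $\{0,\dots,d\}$ and unitary monomial matrices $W_k$ (a diagonal matrix with entries of modulus one times a permutation matrix). Let $B\in M_m(\mathbb F_2)$ be symmetric with irreducible characteristic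 polynomial, and let $p_1,\dots,p_d$ be an enumeration of all $2^m$ polynomials over $\mathbb F_2$ of degree less than $m$. Consider the classes $\mathcal C_0,\dots,\mathcal C_d$ generated by $G_0=(\mathbf 1_m,0_m)^t$ and $\bar G_k=(p_k(B),\mathbf 1_m)^t$, $1\le k\le d$. \begin{enumerate} \item All these classes have eigenbases, and every family $(\mathcal B_k)_{k=0}^d$ of eigenbases of $\mathcal C_0,\dots,\mathcal C_d$ is a complete set of mutually unbiased bases: the $d+1$ bases are orthonormal, and $|\langle\psi,\phi\rangle|^2=1/d$ whenever $\psi,\phi$ belong to different bases. \item Any two such complete sets of MUBs, obtained from any two symmetric matrices $B,B'\in M_m(\mathbb F_2)$ with (possibly different) irreducible characteristic polynomials, any enumerations of the polynomials and any choice of the eigenbases, are equivalent. \item Each of them is equivalent to the Wootters--Fields MUBs: given any basis $f_1,\dots,f_m$ over $\mathbb F_2$ of a field with $2^m$ elements, and $f_af_b=\sum_c\alpha^{(c)}_{ab}f_c$, these are the standard basis together with, for each $r\in\mathbb F_2^m$ (in any order), the basis $(v^{(r)}_k)_{k\in\mathbb F_2^m}$ with components $(v^{(r)}_k)_l=2^{-m/2}\,i^{\,l^t(\sum_c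 r_c\alpha^{(c)})l}\,(-1)^{k\cdot l}$, $l\in\mathbb F_2^m$, where in the exponents the entries of $r,\alpha,k,l$ are read as the integers $0,1$. \end{enumerate} -/

import Mathlib

open scoped Polynomial

/-- A matrix `W` is monomial if it is a diagonal matrix with entries of modulus one times a
permutation matrix. -/
def IsMonomial {ι : Type*} [Fintype ι] [DecidableEq ι] (W : Matrix ι ι ℂ) : Prop :=
  ∃ (lam : ι → ℂ) (σ : Equiv.Perm ι), (∀ i, ‖lam i‖ = 1) ∧
    W = Matrix.diagonal lam * σ.permMatrix ℂ

/-- Two bases, given as the columns of two square matrices, are mutually unbiased if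
`|⟨ψ_i, φ_j⟩|² = 1 / d` for all `i`, `j`. -/
def MutuallyUnbiased {ι : Type*} [Fintype ι] (U V : Matrix ι ι ℂ) : Prop :=
  ∀ i j, ‖star (U.col i) ⬝ᵥ V.col j‖ ^ 2 = 1 / (Fintype.card ι : ℝ)

/-- A complete set of mutually unbiased bases of `ℂ^d` (`d` the cardinality of `ι`): `d + 1`
orthonormal bases, given as the columns of unitary matrices, which are pairwise mutually
unbiased. -/
structure IsCompleteMUB {ι : Type*} [Fintype ι] [DecidableEq ι] {r : ℕ}
    (𝔅 : Fin r → Matrix ι ι ℂ) : Prop where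
  card_eq : r = Fintype.card ι + 1
  unitary : ∀ k, 𝔅 k ∈ Matrix.unitaryGroup ι ℂ
  unbiased : ∀ k l, k ≠ l → MutuallyUnbiased (𝔅 k) (𝔅 l)

/-- Two families of bases are equivalent: `𝔅' k = U * 𝔅 (π k) * W k` for one unitary `U`, one
permutation `π` of the indices, and monomial matrices `W k`. -/
def EquivalentBases {ι : Type*} [Fintype ι] [DecidableEq ι] {r : ℕ}
    (𝔅 𝔅' : Fin r → Matrix ι ι ℂ) : Prop :=
  ∃ U ∈ Matrix.unitaryGroup ι ℂ, ∃ (π : Equiv.Perm (Fin r)) (W : Fin r → Matrix ι ι ℂ),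
    (∀ k, IsMonomial (W k)) ∧ ∀ k, 𝔅' k = U * 𝔅 (π k) * W k

/-- The Pauli matrix with `X |i⟩ = |i + 1⟩`. -/
def pauliX : Matrix (ZMod 2) (ZMod 2) ℂ := Matrix.of fun i j => if i = j + 1 then 1 else 0

/-- The Pauli matrix with `Z |i⟩ = (-1)^i |i⟩`. -/
def pauliZ : Matrix (ZMod 2) (ZMod 2) ℂ := Matrix.diagonal fun i => (-1) ^ i.val

/-- The tensor product `A_1 ⊗ ⋯ ⊗ A_m` of operators on `ℂ²`, as a matrix in the standard basis
`|i_1, …, i_m⟩` of `ℂ^d`, `d = 2 ^ m`. -/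
def qubitTensor {m : ℕ} (A : Fin m → Matrix (ZMod 2) (ZMod 2) ℂ) :
    Matrix (Fin m → ZMod 2) (Fin m → ZMod 2) ℂ :=
  Matrix.of fun i j => ∏ k, A k (i k) (j k)

/-- The Pauli operator of the vector `a = (a_z | a_x)`, where `a_z` is the `Sum.inl` part and `a_x`
the `Sum.inr` part. -/
def pauliXZ {m : ℕ} (a : Fin m ⊕ Fin m → ZMod 2) :
    Matrix (Fin m → ZMod 2) (Fin m → ZMod 2) ℂ :=
  Complex.I ^ (∑ k, (a (Sum.inr k)).val * (a (Sum.inl k)).val) •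
    qubitTensor fun k => pauliX ^ (a (Sum.inr k)).val * pauliZ ^ (a (Sum.inl k)).val

/-- The class of Pauli operators generated by a `2m × m` matrix `G`. -/
def pauliClass {m : ℕ} (G : Matrix (Fin m ⊕ Fin m) (Fin m) (ZMod 2)) :
    Set (Matrix (Fin m → ZMod 2) (Fin m → ZMod 2) ℂ) :=
  {A | ∃ c : Fin m → ZMod 2, c ≠ 0 ∧ A = pauliXZ (G.mulVec c)}

/-- The generators `(1, 0)ᵗ` (index `0`) and `(p_k(B), 1)ᵗ` (the other `2 ^ m` indices). -/
noncomputable def generators {m : ℕ} (B : Matrix (Fin m) (Fin m) (ZMod 2))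
    (p : Fin (2 ^ m) → (ZMod 2)[X]) :
    Fin (2 ^ m + 1) → Matrix (Fin m ⊕ Fin m) (Fin m) (ZMod 2) :=
  Fin.cons (Matrix.fromRows 1 0) fun k => Matrix.fromRows (Polynomial.aeval B (p k)) 1

/-- The columns of `U` form an orthonormal basis of common eigenvectors of the operators in `𝒞`. -/
def IsEigenbasis {ι : Type*} [Fintype ι] [DecidableEq ι] (𝒞 : Set (Matrix ι ι ℂ))
    (U : Matrix ι ι ℂ) : Prop :=
  U ∈ Matrix.unitaryGroup ι ℂ ∧ ∀ A ∈ 𝒞, ∀ j, ∃ μ : ℂ, A.mulVec (U.col j) = μ • U.col j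

/-- `𝔅` consists of eigenbases of the Pauli classes generated by `(1, 0)ᵗ` and
`(p_k(B), 1)ᵗ`. -/
def AreEigenbases {m : ℕ} (B : Matrix (Fin m) (Fin m) (ZMod 2))
    (p : Fin (2 ^ m) → (ZMod 2)[X])
    (𝔅 : Fin (2 ^ m + 1) → Matrix (Fin m → ZMod 2) (Fin m → ZMod 2) ℂ) : Prop :=
  ∀ k, IsEigenbasis (pauliClass (generators B p k)) (𝔅 k)

/-- The structure constants `α^{(c)}_{ab}` of a basis `f` of a field over `𝔽₂`:
`f_a f_b = ∑_c α^{(c)}_{ab} f_c`. -/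
noncomputable def structureConst {m : ℕ} {K : Type*} [Field K] [Algebra (ZMod 2) K]
    (f : Module.Basis (Fin m) (ZMod 2) K) (c a b : Fin m) : ZMod 2 :=
  f.repr (f a * f b) c

/-- The Wootters–Fields basis with label `r`. Its vector `v_k` (column `k`) has the components
`(v_k)_l = 2^{-m/2} i^{lᵗ (∑_c r_c α^{(c)}) l} (-1)^{k ⬝ l}`, where the entries of `r`, `α`, `k`,
`l` are read as the integers `0`, `1`. -/
noncomputable def woottersFieldsBasis {m : ℕ} {K : Type*} [Field K] [Algebra (ZMod 2) K]
    (f : Module.Basis (Fin m) (ZMod 2) K) (r : Fin m → ZMod 2) :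
    Matrix (Fin m → ZMod 2) (Fin m → ZMod 2) ℂ :=
  Matrix.of fun l k =>
    ((1 / Real.sqrt (2 ^ m) : ℝ) : ℂ) *
      Complex.I ^ (∑ a, ∑ b,
        (l a).val * (∑ c, (r c).val * (structureConst f c a b).val) * (l b).val) *
      (-1) ^ (∑ a, (k a).val * (l a).val)

/-- The Wootters–Fields MUBs in dimension `2 ^ m`: the standard basis (index `0`) and the bases
labelled by the `2 ^ m` vectors `r` over `𝔽₂`, in the order given by `e`. -/
noncomputable def woottersFields {m : ℕ} {K : Type*} [Field K] [Algebra (ZMod 2) K]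
    (f : Module.Basis (Fin m) (ZMod 2) K) (e : Fin (2 ^ m) ≃ (Fin m → ZMod 2)) :
    Fin (2 ^ m + 1) → Matrix (Fin m → ZMod 2) (Fin m → ZMod 2) ℂ :=
  Fin.cons 1 fun k => woottersFieldsBasis f (e k)

/-!
For a symmetric matrix `S` over `𝔽₂`, lifted to a symmetric integer matrix `M`, the function
`l ↦ i ^ (lᵗ M l)` on `𝔽₂ ^ m` is a quadratic character: translating `l` by `c` multiplies it by a
scalar and by `(-1) ^ (lᵗ S c)` (`quadPhase_add`). Hence the basis `quadBasis M`, which is this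
function times the characters of `𝔽₂ ^ m`, consists of common eigenvectors of the Pauli operators
of `(S c | c)`; as distinct vectors have distinct eigenvalues, every eigenbasis of the class
`(S, 1)ᵗ` is `quadBasis M` up to order and phases (`IsSeparatingEigenbasis.sameBasis`). In the same
way the standard basis is the eigenbasis of `(1, 0)ᵗ`. The Wootters–Fields bases are of the form
`quadBasis M` by definition.

Mutual unbiasedness of two such bases is the evaluation of the modulus of a Gauss sum, which needs
the difference of the two symmetric matrices to be invertible (`mutuallyUnbiased_quadBasis`). This
holds for the values `p_k(B)`, because the characteristic polynomial of `B` is irreducible of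
degree `m`.

For the equivalence, let `φ` be an isomorphism from a field `K` with `2 ^ m` elements onto
`𝔽₂[B]`, and let `v ≠ 0`. Then `x ↦ φ(x) v` is a bijection `K → 𝔽₂ ^ m`. Since `B` is symmetric, it
turns the bilinear form of `φ(s)` into `(x, y) ↦ Λ_s(x y)`, where `Λ_s(x) = v ⬝ φ(s x) v`; the `Λ_s`
are all the linear functionals on `K`. In a basis of `K`, the forms `Λ(x y)` are exactly those of
the Wootters–Fields bases. So the permutation of the standard basis given by this bijection carries
the eigenbases to the Wootters–Fields bases
(`AreEigenbases.equivalentBases_woottersFields`), and any two families of eigenbases are equivalent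
through the Wootters–Fields bases of one field.
-/

/-! ### Monomial matrices and equivalence of families of bases -/

theorem MutuallyUnbiased.symm {ι : Type*} [Fintype ι] {U V : Matrix ι ι ℂ}
    (h : MutuallyUnbiased U V) :
    MutuallyUnbiased V U := by
  intro i j
  rw [← h j i, ← norm_star (star (V.col i) ⬝ᵥ U.col j), ← Matrix.star_dotProduct]

section Monomial

variable {ι : Type*} [Fintype ι] [DecidableEq ι]

theorem isMonomial_iff_apply {W : Matrix ι ι ℂ} :
    IsMonomial W ↔ ∃ (lam : ι → ℂ) (σ : Equiv.Perm ι), (∀ i, ‖lam i‖ = 1) ∧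
      ∀ i j, W i j = if σ i = j then lam i else 0 := by
  refine exists_congr fun lam => exists_congr fun σ => and_congr_right fun _ => ?_
  rw [← Matrix.ext_iff]
  simp [Matrix.diagonal_mul, PEquiv.toMatrix_apply, Equiv.toPEquiv_apply]

theorem mul_apply_of_monomial {W : Matrix ι ι ℂ} {lam : ι → ℂ} {σ : Equiv.Perm ι}
    (hW : ∀ i j, W i j = if σ i = j then lam i else 0) (V : Matrix ι ι ℂ) (l j : ι) :
    (V * W) l (σ j) = V l j * lam j := by
  simp [Matrix.mul_apply, hW]

namespace IsMonomial

theorem mul {W W' : Matrix ι ι ℂ} (hW : IsMonomial W) (hW' : IsMonomial W') :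
    IsMonomial (W * W') := by
  obtain ⟨lam, σ, hl, h⟩ := isMonomial_iff_apply.1 hW
  obtain ⟨lam', σ', hl', h'⟩ := isMonomial_iff_apply.1 hW'
  refine isMonomial_iff_apply.2 ⟨fun i => lam i * lam' (σ i), σ' * σ, by simp [hl, hl'], ?_⟩
  intro i j
  rw [Matrix.mul_apply, Finset.sum_eq_single (σ i)]
  · rw [h, h', if_pos rfl, Equiv.Perm.mul_apply]
    split_ifs <;> simp
  · intro x _ hx
    rw [h, if_neg (Ne.symm hx), zero_mul]
  · simp

theorem conjTranspose {W : Matrix ι ι ℂ} (hW : IsMonomial W) : IsMonomial W.conjTranspose := by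
  obtain ⟨lam, σ, hl, h⟩ := isMonomial_iff_apply.1 hW
  refine isMonomial_iff_apply.2 ⟨fun i => star (lam (σ.symm i)), σ.symm, by simp [hl], ?_⟩
  intro i j
  by_cases hij : σ j = i
  · subst hij; simp [h]
  · have : σ.symm i ≠ j := by rintro rfl; simp at hij
    simp [h, hij, this]

theorem mem_unitaryGroup {W : Matrix ι ι ℂ} (hW : IsMonomial W) :
    W ∈ Matrix.unitaryGroup ι ℂ := by
  obtain ⟨lam, σ, hl, h⟩ := isMonomial_iff_apply.1 hW
  rw [Matrix.mem_unitaryGroup_iff]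
  ext i j
  have hi : lam i * (starRingEnd ℂ) (lam i) = 1 := by rw [Complex.mul_conj']; simp [hl]
  by_cases hij : i = j
  · subst hij; simp [Matrix.mul_apply, Matrix.star_apply, h, hi]
  · have : σ j ≠ σ i := fun e => hij (σ.injective e.symm)
    simp [Matrix.mul_apply, Matrix.star_apply, h, hij, this]

end IsMonomial

/-- Two bases, given as the columns of square matrices, agree up to the order of their vectors and
up to phases. -/
def SameBasis (V V' : Matrix ι ι ℂ) : Prop :=
  ∃ W, IsMonomial W ∧ V' = V * W

namespace SameBasis

theorem symm {V V' : Matrix ι ι ℂ} (h : SameBasis V V') : SameBasis V' V := by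
  obtain ⟨W, hW, rfl⟩ := h
  refine ⟨W.conjTranspose, hW.conjTranspose, ?_⟩
  rw [Matrix.mul_assoc, ← Matrix.star_eq_conjTranspose,
    Matrix.mem_unitaryGroup_iff.1 hW.mem_unitaryGroup, Matrix.mul_one]

theorem trans {V V' V'' : Matrix ι ι ℂ} (h : SameBasis V V') (h' : SameBasis V' V'') :
    SameBasis V V'' := by
  obtain ⟨W, hW, rfl⟩ := h
  obtain ⟨W', hW', rfl⟩ := h'
  exact ⟨W * W', hW.mul hW', Matrix.mul_assoc _ _ _⟩

theorem mul_left {V V' : Matrix ι ι ℂ} (h : SameBasis V V') (U : Matrix ι ι ℂ) :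
    SameBasis (U * V) (U * V') := by
  obtain ⟨W, hW, rfl⟩ := h
  exact ⟨W, hW, (Matrix.mul_assoc _ _ _).symm⟩

/-- A unitary matrix with at most one nonzero entry in each column is monomial. -/
theorem one_of_col_unique {T : Matrix ι ι ℂ} (hT : T ∈ Matrix.unitaryGroup ι ℂ)
    (h : ∀ j k k', T k j ≠ 0 → T k' j ≠ 0 → k = k') : SameBasis 1 T := by
  have hTT := Matrix.mem_unitaryGroup_iff'.1 hT
  have hne : ∀ j, ∃ k, T k j ≠ 0 := by
    intro j
    by_contra! hj
    have := congrFun (congrFun hTT j) j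
    simp [Matrix.mul_apply, hj] at this
  choose τ hτ using hne
  have hsupp : ∀ j k, k ≠ τ j → T k j = 0 := fun j k hk => by
    by_contra h0
    exact hk (h j _ _ h0 (hτ j))
  have hsum : ∀ i j, star (T (τ i) i) * T (τ i) j = (1 : Matrix ι ι ℂ) i j := by
    intro i j
    rw [← hTT, Matrix.mul_apply, Finset.sum_eq_single (τ i)]
    · simp [Matrix.star_apply]
    · intro k _ hk
      simp [Matrix.star_apply, hsupp i k hk]
    · simp
  have hinj : Function.Injective τ := by
    intro i j hij
    by_contra hne
    have := hsum i j
    rw [Matrix.one_apply_ne hne] at this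
    rcases mul_eq_zero.1 this with h0 | h0
    · exact hτ i (star_eq_zero.1 h0)
    · rw [hij] at h0; exact hτ j h0
  let σ : Equiv.Perm ι := Equiv.ofBijective τ hinj.bijective_of_finite
  have hσ : ∀ j, σ j = τ j := fun j => rfl
  refine ⟨T, isMonomial_iff_apply.2 ⟨fun i => T i (σ.symm i), σ.symm, ?_, ?_⟩, by simp⟩
  · intro i
    obtain ⟨j, rfl⟩ := σ.surjective i
    have := congrArg norm (hsum j j)
    simp only [norm_mul, norm_star, Matrix.one_apply_eq, norm_one] at this
    change ‖T (σ j) (σ.symm (σ j))‖ = 1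
    rw [Equiv.symm_apply_apply, hσ]
    nlinarith [norm_nonneg (T (τ j) j)]
  · intro i j
    split_ifs with hij
    · exact congrArg (T i) hij.symm
    · refine hsupp j i fun e => hij ?_
      rw [e, ← hσ, Equiv.symm_apply_apply]

end SameBasis

theorem MutuallyUnbiased.of_sameBasis {U V U' V' : Matrix ι ι ℂ} (h : MutuallyUnbiased U V)
    (hU : SameBasis U U') (hV : SameBasis V V') : MutuallyUnbiased U' V' := by
  obtain ⟨W, hW, rfl⟩ := hU
  obtain ⟨W', hW', rfl⟩ := hV
  obtain ⟨lam, σ, hl, hW⟩ := isMonomial_iff_apply.1 hW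
  obtain ⟨lam', σ', hl', hW'⟩ := isMonomial_iff_apply.1 hW'
  intro i j
  obtain ⟨i, rfl⟩ := σ.surjective i
  obtain ⟨j, rfl⟩ := σ'.surjective j
  rw [← h i j]
  have : star ((U * W).col (σ i)) ⬝ᵥ (V * W').col (σ' j) =
      star (lam i) * lam' j * (star (U.col i) ⬝ᵥ V.col j) := by
    simp only [dotProduct, Finset.mul_sum, Pi.star_apply, Matrix.col_apply,
      mul_apply_of_monomial hW, mul_apply_of_monomial hW', star_mul']
    exact Finset.sum_congr rfl fun _ _ => by ring
  rw [this, norm_mul, norm_mul, norm_star, hl, hl', one_mul, one_mul]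

theorem equivalentBases_of_sameBasis {r : ℕ} {𝔅 𝔅' : Fin r → Matrix ι ι ℂ} {U : Matrix ι ι ℂ}
    (hU : U ∈ Matrix.unitaryGroup ι ℂ) (π : Equiv.Perm (Fin r))
    (h : ∀ k, SameBasis (U * 𝔅 (π k)) (𝔅' k)) : EquivalentBases 𝔅 𝔅' := by
  choose W hW h using h
  exact ⟨U, hU, π, W, hW, h⟩

namespace EquivalentBases

variable {r : ℕ} {𝔅 𝔅' 𝔅'' : Fin r → Matrix ι ι ℂ}

theorem symm (h : EquivalentBases 𝔅 𝔅') : EquivalentBases 𝔅' 𝔅 := by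
  obtain ⟨U, hU, π, W, hW, h⟩ := h
  refine equivalentBases_of_sameBasis (Unitary.star_mem hU) π.symm fun k => ?_
  have : SameBasis (U * 𝔅 k) (𝔅' (π.symm k)) :=
    ⟨W (π.symm k), hW _, by rw [h, Equiv.apply_symm_apply]⟩
  have := this.symm.mul_left (star U)
  rwa [← Matrix.mul_assoc (star U) U, Matrix.mem_unitaryGroup_iff'.1 hU, Matrix.one_mul] at this

theorem trans (h : EquivalentBases 𝔅 𝔅') (h' : EquivalentBases 𝔅' 𝔅'') :
    EquivalentBases 𝔅 𝔅'' := by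
  obtain ⟨U, hU, π, W, hW, h⟩ := h
  obtain ⟨U', hU', π', W', hW', h'⟩ := h'
  refine ⟨U' * U, mul_mem hU' hU, π'.trans π, fun k => W (π' k) * W' k,
    fun k => (hW _).mul (hW' k), fun k => ?_⟩
  rw [h', h, Equiv.trans_apply]
  simp only [Matrix.mul_assoc]

end EquivalentBases

/-! ### Uniqueness of eigenbases -/

/-- The columns of `V` are common eigenvectors of the operators in `𝒞`, and any two columns are
told apart by their eigenvalues for some operator in `𝒞`. -/
def IsSeparatingEigenbasis (𝒞 : Set (Matrix ι ι ℂ)) (V : Matrix ι ι ℂ) : Prop :=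
  IsEigenbasis 𝒞 V ∧ ∀ k k', k ≠ k' → ∃ A ∈ 𝒞, ∃ μ : ι → ℂ,
    (∀ j, A.mulVec (V.col j) = μ j • V.col j) ∧ μ k ≠ μ k'

theorem mul_eq_mul_diagonal_iff {A V : Matrix ι ι ℂ} {μ : ι → ℂ} :
    A * V = V * Matrix.diagonal μ ↔ ∀ j, A.mulVec (V.col j) = μ j • V.col j := by
  rw [← Matrix.ext_iff]
  constructor
  · intro h j
    ext i
    have := h i j
    rw [Matrix.mul_diagonal] at this
    rw [Pi.smul_apply, smul_eq_mul, mul_comm, Matrix.col_apply, ← this]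
    rfl
  · intro h i j
    have := congrFun (h j) i
    rw [Pi.smul_apply, smul_eq_mul, mul_comm, Matrix.col_apply] at this
    rw [Matrix.mul_diagonal, ← this]
    rfl

/-- If the joint eigenspaces are lines, then the eigenbasis is unique up to order and phases: the
transition matrix commutes with the diagonalised operators, so each of its columns is supported on
one joint eigenspace. -/
theorem IsSeparatingEigenbasis.sameBasis {𝒞 : Set (Matrix ι ι ℂ)} {V U : Matrix ι ι ℂ}
    (hV : IsSeparatingEigenbasis 𝒞 V) (hU : IsEigenbasis 𝒞 U) : SameBasis V U := by
  obtain ⟨⟨hVu, -⟩, hsep⟩ := hV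
  obtain ⟨hUu, hU⟩ := hU
  have hVV := Matrix.mem_unitaryGroup_iff'.1 hVu
  have hT : SameBasis 1 (star V * U) := by
    refine SameBasis.one_of_col_unique (mul_mem (Unitary.star_mem hVu) hUu) ?_
    intro j k k' hk hk'
    by_contra hne
    obtain ⟨A, hA, μ, hμ, hμne⟩ := hsep k k' hne
    choose ν hν using hU A hA
    have h1 := mul_eq_mul_diagonal_iff.2 hμ
    have h2 := mul_eq_mul_diagonal_iff.2 hν
    have h3 : Matrix.diagonal μ * (star V * U) = star V * U * Matrix.diagonal ν := by
      calc Matrix.diagonal μ * (star V * U)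
          = star V * (V * Matrix.diagonal μ) * (star V * U) := by
            rw [← Matrix.mul_assoc (star V) V, hVV, Matrix.one_mul]
        _ = star V * (A * (V * star V) * U) := by rw [← h1]; simp only [Matrix.mul_assoc]
        _ = star V * U * Matrix.diagonal ν := by
            rw [Matrix.mem_unitaryGroup_iff.1 hVu, Matrix.mul_one, h2, Matrix.mul_assoc]
    have h4 : ∀ i, (star V * U) i j ≠ 0 → μ i = ν j := by
      intro i hi
      have := congrFun (congrFun h3 i) j
      rw [Matrix.diagonal_mul, Matrix.mul_diagonal, mul_comm] at this
      exact mul_left_cancel₀ hi this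
    exact hμne ((h4 k hk).trans (h4 k' hk').symm)
  have := hT.mul_left V
  rwa [Matrix.mul_one, ← Matrix.mul_assoc, Matrix.mem_unitaryGroup_iff.1 hVu,
    Matrix.one_mul] at this

end Monomial

/-! ### Signs -/

/-- The nontrivial character `x ↦ (-1) ^ x` of `𝔽₂`. -/
noncomputable def signChar : AddChar (ZMod 2) ℂ := AddChar.zmodChar 2 (ζ := -1) (by norm_num)

theorem signChar_apply (x : ZMod 2) : signChar x = (-1) ^ x.val := AddChar.zmodChar_apply _ x

theorem signChar_natCast (n : ℕ) : signChar (n : ZMod 2) = (-1) ^ n := AddChar.zmodChar_apply' _ n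

theorem signChar_mul_self (x : ZMod 2) : signChar x * signChar x = 1 := by
  rw [← AddChar.map_add_eq_mul, CharTwo.add_self_eq_zero, AddChar.map_zero_eq_one]

theorem star_signChar (x : ZMod 2) : star (signChar x) = signChar x := by
  simp [signChar_apply]

theorem norm_signChar (x : ZMod 2) : ‖signChar x‖ = 1 := by
  simp [signChar_apply]

theorem signChar_eq_one_iff {x : ZMod 2} : signChar x = 1 ↔ x = 0 := by
  obtain rfl | rfl : x = 0 ∨ x = 1 := by revert x; decide
  · simp
  · rw [signChar_apply, ZMod.val_one]
    norm_num

theorem signChar_injective : Function.Injective signChar := by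
  intro x y h
  have : signChar (x + y) = 1 := by rw [AddChar.map_add_eq_mul, h, signChar_mul_self]
  exact CharTwo.add_eq_zero.1 (signChar_eq_one_iff.1 this)

section Qubits

variable {m : ℕ}

theorem add_self_eq_zero_of_bits (x : Fin m → ZMod 2) : x + x = 0 :=
  funext fun _ => CharTwo.add_self_eq_zero _

theorem add_eq_zero_iff_of_bits {x y : Fin m → ZMod 2} : x + y = 0 ↔ x = y := by
  simp only [funext_iff, Pi.add_apply, Pi.zero_apply, CharTwo.add_eq_zero]

theorem signChar_dotProduct (k l : Fin m → ZMod 2) :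
    signChar (k ⬝ᵥ l) = (-1) ^ (∑ a, (k a).val * (l a).val) := by
  rw [← signChar_natCast]
  congr 1
  push_cast
  simp [dotProduct]

theorem sum_signChar_dotProduct (x : Fin m → ZMod 2) :
    ∑ l, signChar (x ⬝ᵥ l) = if x = 0 then (2 : ℂ) ^ m else 0 := by
  split_ifs with h
  · subst h
    simp [ZMod.card]
  · let ψ : AddChar (Fin m → ZMod 2) ℂ :=
      { toFun := fun l => signChar (x ⬝ᵥ l)
        map_zero_eq_one' := by simp
        map_add_eq_mul' := fun a b => by rw [dotProduct_add, AddChar.map_add_eq_mul] }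
    refine AddChar.sum_eq_zero_of_ne_one (ψ := ψ) fun h1 => h ?_
    ext a
    have := DFunLike.congr_fun h1 (Pi.single a 1)
    change signChar (x ⬝ᵥ Pi.single a 1) = 1 at this
    simpa using signChar_eq_one_iff.1 this

/-! ### The action of Pauli operators -/

theorem pauliX_pow_mul_pauliZ_pow_apply (x z i j : ZMod 2) :
    (pauliX ^ x.val * pauliZ ^ z.val) i j = if i = j + x then signChar (z * j) else 0 := by
  have hZ : ∀ z : ZMod 2, pauliZ ^ z.val = Matrix.diagonal fun j => signChar (z * j) := by
    intro z
    rw [pauliZ, Matrix.diagonal_pow]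
    congr 1
    ext j
    rw [Pi.pow_apply, ← pow_mul, ← signChar_natCast]
    simp [mul_comm z j]
  have hX : ∀ x : ZMod 2, pauliX ^ x.val = Matrix.of fun i j => if i = j + x then 1 else 0 := by
    intro x
    obtain rfl | rfl : x = 0 ∨ x = 1 := by revert x; decide
    · ext i j
      simp [Matrix.one_apply]
    · rw [ZMod.val_one, pow_one, pauliX]
  rw [hZ, hX, Matrix.mul_diagonal]
  simp

theorem qubitTensor_apply (x z i j : Fin m → ZMod 2) :
    qubitTensor (fun k => pauliX ^ (x k).val * pauliZ ^ (z k).val) i j =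
      if i = j + x then signChar (z ⬝ᵥ j) else 0 := by
  simp only [qubitTensor, Matrix.of_apply, pauliX_pow_mul_pauliZ_pow_apply]
  split_ifs with h
  · subst h
    simp only [Pi.add_apply, if_true]
    exact (map_prod signChar.toMonoidHom (fun k => Multiplicative.ofAdd (z k * j k)) _).symm
  · obtain ⟨k, hk⟩ := Function.ne_iff.1 h
    exact Finset.prod_eq_zero (Finset.mem_univ k) (if_neg hk)

/-- The phase in front of the tensor product in a Pauli operator. -/
noncomputable def pauliPhase (a : Fin m ⊕ Fin m → ZMod 2) : ℂ :=
  Complex.I ^ (∑ k, (a (Sum.inr k)).val * (a (Sum.inl k)).val)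

theorem pauliPhase_ne_zero (a : Fin m ⊕ Fin m → ZMod 2) : pauliPhase a ≠ 0 :=
  pow_ne_zero _ Complex.I_ne_zero

theorem pauliXZ_mulVec (x z : Fin m → ZMod 2) (u : (Fin m → ZMod 2) → ℂ) (l : Fin m → ZMod 2) :
    (pauliXZ (Sum.elim z x)).mulVec u l =
      pauliPhase (Sum.elim z x) * (signChar (z ⬝ᵥ (l + x)) * u (l + x)) := by
  have hx : ∀ j : Fin m → ZMod 2, l = j + x ↔ j = l + x := by
    intro j
    constructor <;> rintro rfl <;> rw [add_assoc, add_self_eq_zero_of_bits, add_zero]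
  rw [pauliXZ, Matrix.smul_mulVec, Pi.smul_apply, smul_eq_mul]
  congr 1
  simp only [Matrix.mulVec, dotProduct, Sum.elim_inr, Sum.elim_inl]
  rw [Finset.sum_eq_single (l + x)]
  · rw [qubitTensor_apply, if_pos ((hx _).2 rfl)]
    rfl
  · intro j _ hj
    rw [qubitTensor_apply, if_neg (fun h => hj ((hx j).1 h)), zero_mul]
  · simp

/-- The standard basis is an eigenbasis of the class of the diagonal Pauli operators. -/
theorem one_isSeparatingEigenbasis :
    IsSeparatingEigenbasis (pauliClass (Matrix.fromRows 1 0 : Matrix (Fin m ⊕ Fin m) _ _)) 1 := by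
  have key : ∀ c j : Fin m → ZMod 2,
      (pauliXZ ((Matrix.fromRows 1 0 : Matrix (Fin m ⊕ Fin m) (Fin m) (ZMod 2)).mulVec c)).mulVec
        ((1 : Matrix (Fin m → ZMod 2) (Fin m → ZMod 2) ℂ).col j) =
      (pauliPhase (Sum.elim c 0) * signChar (c ⬝ᵥ j)) •
        (1 : Matrix (Fin m → ZMod 2) (Fin m → ZMod 2) ℂ).col j := by
    intro c j
    ext l
    rw [Matrix.fromRows_mulVec, Matrix.one_mulVec, Matrix.zero_mulVec, pauliXZ_mulVec, add_zero,
      Pi.smul_apply, smul_eq_mul, mul_assoc, Matrix.col_apply]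
    by_cases h : l = j
    · rw [h]
    · simp only [Matrix.one_apply_ne h, mul_zero]
  refine ⟨⟨one_mem _, ?_⟩, ?_⟩
  · rintro _ ⟨c, -, rfl⟩ j
    exact ⟨_, key c j⟩
  · intro k k' hne
    obtain ⟨a, ha⟩ := Function.ne_iff.1 hne
    refine ⟨_, ⟨Pi.single a 1, by simp, rfl⟩, _, key _, fun h => ha ?_⟩
    simpa using signChar_injective (mul_left_cancel₀ (pauliPhase_ne_zero _) h)

/-- A vector that is multiplied by a scalar and the character `(-1) ^ (lᵗ S c)` when its argument
`l` is translated by `c` is an eigenvector of the Pauli operator of `(S c | c)`. -/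
theorem pauliXZ_mulVec_of_map_add {S : Matrix (Fin m) (Fin m) (ZMod 2)}
    {u : (Fin m → ZMod 2) → ℂ} {c : Fin m → ZMod 2} {t : ℂ}
    (h : ∀ l, u (l + c) = u l * t * signChar (l ⬝ᵥ S.mulVec c)) :
    (pauliXZ ((Matrix.fromRows S 1).mulVec c)).mulVec u =
      (pauliPhase (Sum.elim (S.mulVec c) c) * signChar (S.mulVec c ⬝ᵥ c) * t) • u := by
  ext l
  rw [Matrix.fromRows_mulVec, Matrix.one_mulVec, pauliXZ_mulVec, h, Pi.smul_apply, smul_eq_mul,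
    dotProduct_add, AddChar.map_add_eq_mul, dotProduct_comm l]
  linear_combination (pauliPhase (Sum.elim (S.mulVec c) c) * signChar (S.mulVec c ⬝ᵥ c) * t * u l) *
    signChar_mul_self (S.mulVec c ⬝ᵥ l)

/-! ### Quadratic phases -/

/-- The function `l ↦ i ^ (lᵗ M l)`, where the entries of `l` are read as the integers `0`, `1`. -/
noncomputable def quadPhase (M : Matrix (Fin m) (Fin m) ℕ) (l : Fin m → ZMod 2) : ℂ :=
  Complex.I ^ (∑ a, ∑ b, (l a).val * M a b * (l b).val)

theorem norm_quadPhase (M : Matrix (Fin m) (Fin m) ℕ) (l : Fin m → ZMod 2) :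
    ‖quadPhase M l‖ = 1 := by
  simp [quadPhase]

theorem quadPhase_mul_star (M : Matrix (Fin m) (Fin m) ℕ) (l : Fin m → ZMod 2) :
    quadPhase M l * star (quadPhase M l) = 1 := by
  rw [Complex.star_def, Complex.mul_conj', norm_quadPhase]
  norm_num

theorem quadPhase_zero (M : Matrix (Fin m) (Fin m) ℕ) : quadPhase M 0 = 1 := by
  simp [quadPhase]

theorem I_pow_eq_of_natCast_eq {n n' : ℕ} (h : (n : ZMod 4) = n') :
    Complex.I ^ n = Complex.I ^ n' := by
  rw [Complex.I_pow_eq_pow_mod n, Complex.I_pow_eq_pow_mod n',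
    (ZMod.natCast_eq_natCast_iff' n n' 4).1 h]

/-- For symmetric `M`, reducing the entries of `l + c` modulo `2` does not change
`(l + c)ᵗ M (l + c)` modulo `4`, so that the phase is a quadratic character of `𝔽₂ ^ m`. -/
theorem quadPhase_add {M : Matrix (Fin m) (Fin m) ℕ} (hM : M.IsSymm) (l c : Fin m → ZMod 2) :
    quadPhase M (l + c) = quadPhase M l * quadPhase M c *
      signChar (l ⬝ᵥ (M.map (Nat.cast : ℕ → ZMod 2)).mulVec c) := by
  have hs : signChar (l ⬝ᵥ (M.map (Nat.cast : ℕ → ZMod 2)).mulVec c) =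
      Complex.I ^ (2 * ∑ a, ∑ b, (l a).val * M a b * (c b).val) := by
    rw [pow_mul, Complex.I_sq, ← signChar_natCast]
    congr 1
    push_cast
    simp [dotProduct, Matrix.mulVec, Finset.mul_sum, mul_assoc]
  rw [hs, quadPhase, quadPhase, quadPhase, ← pow_add, ← pow_add]
  apply I_pow_eq_of_natCast_eq
  -- `lift x` is `x` with its entries read as `0`, `1` in `ℤ/4`
  let lift : (Fin m → ZMod 2) → Fin m → ZMod 4 := fun x a => ((x a).val : ZMod 4)
  let N : Matrix (Fin m) (Fin m) (ZMod 4) := M.map Nat.cast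
  have hN : ∀ x y : Fin m → ZMod 4, x ⬝ᵥ N.mulVec y = y ⬝ᵥ N.mulVec x := by
    intro x y
    have : N.transpose = N := by rw [← Matrix.transpose_map, hM.eq]
    rw [Matrix.dotProduct_mulVec, ← Matrix.mulVec_transpose, this, dotProduct_comm]
  have hcast : ∀ x y : Fin m → ZMod 2,
      ((∑ a, ∑ b, (x a).val * M a b * (y b).val : ℕ) : ZMod 4) = lift x ⬝ᵥ N.mulVec (lift y) := by
    intro x y
    push_cast
    simp [dotProduct, Matrix.mulVec, Finset.mul_sum, mul_assoc, lift, N]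
  -- `x + y` in `𝔽₂` drops the carry `2 x y`, and `-2 = 2` in `ℤ/4`
  have hcarry : ∀ x y : ZMod 2,
      ((x + y).val : ZMod 4) = x.val + y.val + 2 * (x.val * y.val) := by decide
  have hlift : lift (l + c) = lift l + lift c + (2 : ZMod 4) • (lift l * lift c) := by
    ext a
    exact hcarry (l a) (c a)
  have h4 : (4 : ZMod 4) = 0 := rfl
  rw [Nat.cast_add, Nat.cast_add, Nat.cast_mul, hcast, hcast, hcast, hcast, hlift]
  simp only [Matrix.mulVec_add, Matrix.mulVec_smul, dotProduct_add, add_dotProduct,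
    smul_dotProduct, dotProduct_smul, smul_eq_mul, Nat.cast_ofNat]
  rw [hN (lift c) (lift l), hN (lift l * lift c) (lift l), hN (lift l * lift c) (lift c)]
  linear_combination (lift l ⬝ᵥ N.mulVec (lift l * lift c) + lift c ⬝ᵥ N.mulVec (lift l * lift c) +
    (lift l * lift c) ⬝ᵥ N.mulVec (lift l * lift c)) * h4

/-- The basis with vectors `v_k`, `(v_k)_l = 2 ^ (-m / 2) i ^ (lᵗ M l) (-1) ^ (k ⬝ l)`. -/
noncomputable def quadBasis (M : Matrix (Fin m) (Fin m) ℕ) :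
    Matrix (Fin m → ZMod 2) (Fin m → ZMod 2) ℂ :=
  Matrix.of fun l k => ((1 / Real.sqrt (2 ^ m) : ℝ) : ℂ) * quadPhase M l * signChar (k ⬝ᵥ l)

theorem quadBasis_apply (M : Matrix (Fin m) (Fin m) ℕ) (l k : Fin m → ZMod 2) :
    quadBasis M l k =
      ((1 / Real.sqrt (2 ^ m) : ℝ) : ℂ) * quadPhase M l * signChar (k ⬝ᵥ l) := rfl

theorem inv_sqrt_mul_self (m : ℕ) :
    ((1 / Real.sqrt (2 ^ m) : ℝ) : ℂ) * ((1 / Real.sqrt (2 ^ m) : ℝ) : ℂ) = 1 / 2 ^ m := by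
  rw [← Complex.ofReal_mul, div_mul_div_comm, Real.mul_self_sqrt (by positivity)]
  simp

theorem star_quadBasis_dotProduct (M N : Matrix (Fin m) (Fin m) ℕ) (i j : Fin m → ZMod 2) :
    star ((quadBasis M).col i) ⬝ᵥ (quadBasis N).col j =
      1 / 2 ^ m * ∑ l, star (quadPhase M l) * quadPhase N l * signChar ((i + j) ⬝ᵥ l) := by
  rw [Finset.mul_sum, dotProduct, ← inv_sqrt_mul_self]
  refine Finset.sum_congr rfl fun l _ => ?_
  rw [Pi.star_apply, Matrix.col_apply, Matrix.col_apply, quadBasis_apply, quadBasis_apply,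
    star_mul', star_mul', star_signChar, add_dotProduct, AddChar.map_add_eq_mul]
  rw [Complex.star_def, Complex.conj_ofReal]
  ring

theorem quadBasis_mem_unitaryGroup (M : Matrix (Fin m) (Fin m) ℕ) :
    quadBasis M ∈ Matrix.unitaryGroup (Fin m → ZMod 2) ℂ := by
  rw [Matrix.mem_unitaryGroup_iff']
  ext i j
  have h : (star (quadBasis M) * quadBasis M) i j =
    star ((quadBasis M).col i) ⬝ᵥ (quadBasis M).col j := rfl
  rw [h, star_quadBasis_dotProduct]
  simp only [mul_comm (star (quadPhase M _)), quadPhase_mul_star, one_mul]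
  rw [sum_signChar_dotProduct, Matrix.one_apply]
  simp only [add_eq_zero_iff_of_bits]
  split_ifs <;> simp

/-! ### Eigenbases of the classes `(S, 1)ᵗ` -/

/-- The eigenvalues of the Pauli operator of `(S c | c)` on the quadratic basis: up to a factor
independent of `k`, the eigenvalue of `v_k` is `(-1) ^ (k ⬝ c)`. -/
theorem pauliXZ_mulVec_quadBasis {M : Matrix (Fin m) (Fin m) ℕ} (hM : M.IsSymm)
    (c k : Fin m → ZMod 2) :
    (pauliXZ ((Matrix.fromRows (M.map (Nat.cast : ℕ → ZMod 2)) 1).mulVec c)).mulVec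
        ((quadBasis M).col k) =
      (pauliPhase (Sum.elim ((M.map (Nat.cast : ℕ → ZMod 2)).mulVec c) c) *
        signChar ((M.map (Nat.cast : ℕ → ZMod 2)).mulVec c ⬝ᵥ c) *
        (quadPhase M c * signChar (k ⬝ᵥ c))) • (quadBasis M).col k := by
  refine pauliXZ_mulVec_of_map_add fun l => ?_
  rw [Matrix.col_apply, Matrix.col_apply, quadBasis_apply, quadBasis_apply, quadPhase_add hM,
    dotProduct_add, AddChar.map_add_eq_mul]
  ring

theorem quadBasis_isSeparatingEigenbasis {M : Matrix (Fin m) (Fin m) ℕ} (hM : M.IsSymm) :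
    IsSeparatingEigenbasis (pauliClass (Matrix.fromRows (M.map (Nat.cast : ℕ → ZMod 2)) 1))
      (quadBasis M) := by
  refine ⟨⟨quadBasis_mem_unitaryGroup M, ?_⟩, ?_⟩
  · rintro _ ⟨c, -, rfl⟩ j
    exact ⟨_, pauliXZ_mulVec_quadBasis hM c j⟩
  · intro k k' hne
    obtain ⟨a, ha⟩ := Function.ne_iff.1 hne
    refine ⟨_, ⟨Pi.single a 1, by simp, rfl⟩, _, pauliXZ_mulVec_quadBasis hM _, fun h => ha ?_⟩
    have hs : ∀ x, signChar x ≠ 0 := fun x h0 => by simpa [h0] using norm_signChar x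
    have hq : quadPhase M (Pi.single a 1) ≠ 0 := fun h0 => by
      simpa [h0] using norm_quadPhase M (Pi.single a 1)
    have := mul_left_cancel₀ (mul_ne_zero (pauliPhase_ne_zero _) (hs _)) h
    simpa using signChar_injective (mul_left_cancel₀ hq this)

/-- The entries of a matrix over `𝔽₂`, read as the integers `0`, `1`. -/
def natLift (S : Matrix (Fin m) (Fin m) (ZMod 2)) : Matrix (Fin m) (Fin m) ℕ :=
  S.map ZMod.val

theorem natLift_map_natCast (S : Matrix (Fin m) (Fin m) (ZMod 2)) :
    (natLift S).map (Nat.cast : ℕ → ZMod 2) = S := by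
  ext; simp [natLift]

theorem natLift_isSymm {S : Matrix (Fin m) (Fin m) (ZMod 2)} (hS : S.IsSymm) :
    (natLift S).IsSymm := hS.map _

/-! ### Mutual unbiasedness -/

theorem mutuallyUnbiased_one_quadBasis (M : Matrix (Fin m) (Fin m) ℕ) :
    MutuallyUnbiased 1 (quadBasis M) := by
  intro i j
  have : star ((1 : Matrix (Fin m → ZMod 2) (Fin m → ZMod 2) ℂ).col i) ⬝ᵥ (quadBasis M).col j =
      quadBasis M i j := by
    simp [dotProduct, Matrix.one_apply, apply_ite]
  rw [this, quadBasis_apply, norm_mul, norm_mul, norm_quadPhase, norm_signChar, Complex.norm_real]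
  simp [ZMod.card]

/-- The modulus of a Gauss sum: if `N - M` is invertible modulo `2`, then the product `g` of
`conj (quadPhase M)`, `quadPhase N` and a character is a nondegenerate quadratic character, and in
`|∑ g|² = ∑_c g(c) ∑_l (-1) ^ (lᵗ (N - M) c)` only the term `c = 0` survives. -/
theorem mutuallyUnbiased_quadBasis {M N : Matrix (Fin m) (Fin m) ℕ} (hM : M.IsSymm)
    (hN : N.IsSymm)
    (h : IsUnit (N.map (Nat.cast : ℕ → ZMod 2) - M.map (Nat.cast : ℕ → ZMod 2))) :
    MutuallyUnbiased (quadBasis M) (quadBasis N) := by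
  intro i j
  set D := N.map (Nat.cast : ℕ → ZMod 2) - M.map (Nat.cast : ℕ → ZMod 2) with hD
  let g : (Fin m → ZMod 2) → ℂ :=
    fun l => star (quadPhase M l) * quadPhase N l * signChar ((i + j) ⬝ᵥ l)
  have hg0 : g 0 = 1 := by simp [g, quadPhase_zero]
  have hgnorm : ∀ l, g l * star (g l) = 1 := by
    intro l
    rw [Complex.star_def, Complex.mul_conj']
    simp [g, norm_quadPhase]
  have hgadd : ∀ l c, g (l + c) = g l * g c * signChar (D.mulVec c ⬝ᵥ l) := by
    intro l c
    simp only [g]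
    rw [quadPhase_add hM, quadPhase_add hN, dotProduct_add, AddChar.map_add_eq_mul,
      hD, Matrix.sub_mulVec, sub_dotProduct, CharTwo.sub_eq_add, AddChar.map_add_eq_mul,
      dotProduct_comm (Matrix.mulVec _ c) l, dotProduct_comm (Matrix.mulVec _ c) l, star_mul',
      star_mul', star_signChar]
    ring
  have hDc : ∀ c, D.mulVec c = 0 ↔ c = 0 := by
    intro c
    refine ⟨fun hc => ?_, fun hc => by rw [hc, Matrix.mulVec_zero]⟩
    exact Matrix.mulVec_injective_of_isUnit h (by rw [hc, Matrix.mulVec_zero])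
  have hsum : (∑ l, g l) * star (∑ l, g l) = 2 ^ m := by
    calc (∑ l, g l) * star (∑ l, g l)
        = ∑ l, ∑ c, g (l + c) * star (g l) := by
          rw [star_sum, Finset.mul_sum]
          refine Finset.sum_congr rfl fun l _ => ?_
          rw [← Finset.sum_mul]
          exact congrArg (· * star (g l)) (Equiv.sum_comp (Equiv.addLeft l) g).symm
      _ = ∑ l, ∑ c, g c * signChar (D.mulVec c ⬝ᵥ l) := by
          refine Finset.sum_congr rfl fun l _ => Finset.sum_congr rfl fun c _ => ?_
          rw [hgadd]
          linear_combination (g c * signChar (D.mulVec c ⬝ᵥ l)) * hgnorm l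
      _ = 2 ^ m := by
          rw [Finset.sum_comm]
          simp only [← Finset.mul_sum, sum_signChar_dotProduct, hDc]
          simp [hg0]
  have hnorm : ‖∑ l, g l‖ ^ 2 = 2 ^ m := by
    rw [Complex.star_def, Complex.mul_conj'] at hsum
    exact_mod_cast hsum
  rw [star_quadBasis_dotProduct, norm_mul, mul_pow, hnorm]
  simp [ZMod.card]
  field_simp

end Qubits

/-! ### The field generated by a matrix with irreducible characteristic polynomial -/

section MatrixField

variable {m : ℕ} {B : Matrix (Fin m) (Fin m) (ZMod 2)}

theorem pos_of_irreducible_charpoly (hirr : Irreducible B.charpoly) : 0 < m := by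
  have h := hirr.natDegree_pos
  rwa [Matrix.charpoly_natDegree_eq_dim, Fintype.card_fin] at h

/-- A nonzero polynomial of degree less than `m` is coprime to the irreducible characteristic
polynomial of `B`, hence takes an invertible value at `B`. -/
theorem isUnit_aeval_of_degree_lt (hirr : Irreducible B.charpoly) {q : (ZMod 2)[X]} (hq : q ≠ 0)
    (hdeg : q.degree < m) : IsUnit (Polynomial.aeval B q) := by
  have hnd : ¬ B.charpoly ∣ q := by
    intro h
    have := Polynomial.degree_le_of_dvd h hq
    rw [Matrix.charpoly_degree_eq_dim, Fintype.card_fin] at this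
    exact absurd hdeg (not_lt.2 this)
  obtain ⟨a, b, hab⟩ := (hirr.coprime_iff_not_dvd).2 hnd
  have := congrArg (Polynomial.aeval B) hab
  rw [map_add, map_mul, map_mul, Matrix.aeval_self_charpoly, mul_zero, zero_add, map_one] at this
  exact .of_mul_eq_one_right _ this

theorem aeval_isSymm (hB : B.IsSymm) (q : (ZMod 2)[X]) : (Polynomial.aeval B q).IsSymm := by
  induction q using Polynomial.induction_on' with
  | add p q hp hq => rw [map_add]; exact hp.add hq
  | monomial n a =>
    rw [Polynomial.aeval_monomial, Matrix.IsSymm, Matrix.transpose_mul, Matrix.transpose_pow, hB.eq,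
      Algebra.algebraMap_eq_smul_one]
    simp

/-- Every field with `2 ^ m` elements is isomorphic to the matrix field generated by `B`. -/
theorem exists_algHom_range_eq (hirr : Irreducible B.charpoly) (K : Type*) [Field K]
    [Algebra (ZMod 2) K] (f : Module.Basis (Fin m) (ZMod 2) K) :
    ∃ φ : K →ₐ[ZMod 2] Matrix (Fin m) (Fin m) (ZMod 2), φ.range = (Polynomial.aeval B).range := by
  have : Fact (Irreducible B.charpoly) := ⟨hirr⟩
  let b := (AdjoinRoot.powerBasis hirr.ne_zero).basis
  have hfin : Module.Finite (ZMod 2) (AdjoinRoot B.charpoly) := .of_basis b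
  have hfin' : Module.Finite (ZMod 2) K := .of_basis f
  have : Finite (AdjoinRoot B.charpoly) := Module.finite_of_finite (ZMod 2)
  have : Finite K := Module.finite_of_finite (ZMod 2)
  have := Fintype.ofFinite (AdjoinRoot B.charpoly)
  have := Fintype.ofFinite K
  have hcard : Fintype.card K = Fintype.card (AdjoinRoot B.charpoly) := by
    rw [Module.card_fintype f, Module.card_fintype b, Fintype.card_fin, Fintype.card_fin,
      AdjoinRoot.powerBasis_dim, Matrix.charpoly_natDegree_eq_dim, Fintype.card_fin]
  let e : K ≃ₐ[ZMod 2] AdjoinRoot B.charpoly := FiniteField.algEquivOfCardEq 2 hcard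
  let ψ : AdjoinRoot B.charpoly →ₐ[ZMod 2] Matrix (Fin m) (Fin m) (ZMod 2) :=
    Ideal.Quotient.liftₐ (Ideal.span {B.charpoly}) (Polynomial.aeval B) fun q hq => by
      obtain ⟨r, rfl⟩ := Ideal.mem_span_singleton.1 hq
      rw [map_mul, Matrix.aeval_self_charpoly, zero_mul]
  have hψ : ∀ q, ψ (AdjoinRoot.mk _ q) = Polynomial.aeval B q := fun q => rfl
  refine ⟨ψ.comp e.toAlgHom, le_antisymm ?_ ?_⟩
  · rintro _ ⟨x, rfl⟩
    obtain ⟨q, hq⟩ := AdjoinRoot.mk_surjective (e x)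
    exact ⟨q, (hψ q).symm.trans (congrArg ψ hq)⟩
  · rintro _ ⟨q, rfl⟩
    refine ⟨e.symm (AdjoinRoot.mk _ q), ?_⟩
    exact (congrArg ψ (e.apply_symm_apply _)).trans (hψ q)

end MatrixField

/-! ### Relabelling the standard basis -/

section Relabelling

variable {m : ℕ}

theorem isMonomial_permMatrix {ι : Type*} [Fintype ι] [DecidableEq ι] (σ : Equiv.Perm ι) :
    IsMonomial (σ.permMatrix ℂ) :=
  ⟨fun _ => 1, σ, by simp, by simp⟩

/-- An additive relabelling `E` of the standard basis that pulls the bilinear form of `M` back to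
that of `N` maps the quadratic basis of `M` to the one of `N`: the relabelled basis is an
eigenbasis of the class `(N, 1)ᵗ`. -/
theorem sameBasis_permMatrix_mul_quadBasis {M N : Matrix (Fin m) (Fin m) ℕ} (hM : M.IsSymm)
    (hN : N.IsSymm) (E : (Fin m → ZMod 2) ≃+ (Fin m → ZMod 2))
    (h : ∀ l c, E l ⬝ᵥ (M.map (Nat.cast : ℕ → ZMod 2)).mulVec (E c) =
      l ⬝ᵥ (N.map (Nat.cast : ℕ → ZMod 2)).mulVec c) :
    SameBasis (Equiv.Perm.permMatrix ℂ E.toEquiv * quadBasis M) (quadBasis N) := by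
  refine ((quadBasis_isSeparatingEigenbasis hN).sameBasis ⟨mul_mem
    (isMonomial_permMatrix _).mem_unitaryGroup (quadBasis_mem_unitaryGroup M), ?_⟩).symm
  have happ : ∀ l j, (Equiv.Perm.permMatrix ℂ E.toEquiv * quadBasis M) l j =
      quadBasis M (E l) j := fun l j => by
    rw [PEquiv.toMatrix_toPEquiv_mul]; rfl
  rintro _ ⟨c, -, rfl⟩ j
  refine ⟨_, pauliXZ_mulVec_of_map_add (t := quadPhase M (E c) * signChar (j ⬝ᵥ E c)) fun l => ?_⟩
  rw [Matrix.col_apply, Matrix.col_apply, happ, happ, quadBasis_apply, quadBasis_apply, map_add,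
    quadPhase_add hM, dotProduct_add, AddChar.map_add_eq_mul, h]
  ring

/-! ### The Wootters–Fields bases -/

variable {K : Type*} [Field K] [Algebra (ZMod 2) K] (f : Module.Basis (Fin m) (ZMod 2) K)

/-- The integer matrix `∑_c r_c α^{(c)}` of the exponent in the Wootters–Fields basis with
label `r`. -/
noncomputable def woottersFieldsForm (r : Fin m → ZMod 2) : Matrix (Fin m) (Fin m) ℕ :=
  Matrix.of fun a b => ∑ c, (r c).val * (structureConst f c a b).val

theorem woottersFieldsForm_isSymm (r : Fin m → ZMod 2) : (woottersFieldsForm f r).IsSymm := by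
  ext a b
  simp [woottersFieldsForm, structureConst, mul_comm (f a) (f b)]

theorem woottersFieldsBasis_eq_quadBasis (r : Fin m → ZMod 2) :
    woottersFieldsBasis f r = quadBasis (woottersFieldsForm f r) := by
  ext l k
  rw [quadBasis_apply, signChar_dotProduct]
  rfl

/-- Every linear functional on `K` is given on products by the Wootters–Fields form whose label is
the vector of its values on the basis `f`. -/
theorem dotProduct_woottersFieldsForm_mulVec (Λ : K →ₗ[ZMod 2] ZMod 2) (l c : Fin m → ZMod 2) :
    l ⬝ᵥ ((woottersFieldsForm f fun a => Λ (f a)).map (Nat.cast : ℕ → ZMod 2)).mulVec c =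
      Λ (f.equivFun.symm l * f.equivFun.symm c) := by
  have hform : ∀ a b, ((woottersFieldsForm f fun a => Λ (f a)).map (Nat.cast : ℕ → ZMod 2)) a b =
      Λ (f a * f b) := by
    intro a b
    conv_rhs => rw [← f.sum_repr (f a * f b), map_sum]
    simp [woottersFieldsForm, structureConst, mul_comm]
  rw [f.equivFun_symm_apply, f.equivFun_symm_apply, Finset.sum_mul_sum, map_sum]
  refine Finset.sum_congr rfl fun a _ => ?_
  rw [map_sum, Matrix.mulVec, dotProduct, Finset.mul_sum]
  refine Finset.sum_congr rfl fun b _ => ?_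
  rw [hform, smul_mul_smul_comm, map_smul, smul_eq_mul]
  ring

end Relabelling

/-! ### Equivalence with the Wootters–Fields bases -/

section Equivalence

variable {m : ℕ} {B : Matrix (Fin m) (Fin m) (ZMod 2)}
  {p : Fin (2 ^ m) ≃ Polynomial.degreeLT (ZMod 2) m}

theorem isUnit_aeval_sub (hirr : Irreducible B.charpoly)
    (p : Fin (2 ^ m) ≃ Polynomial.degreeLT (ZMod 2) m) {k l : Fin (2 ^ m)} (hkl : k ≠ l) :
    IsUnit (Polynomial.aeval B (p k : (ZMod 2)[X]) - Polynomial.aeval B (p l : (ZMod 2)[X])) := by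
  rw [← map_sub]
  refine isUnit_aeval_of_degree_lt hirr (fun h => hkl ?_) ?_
  · exact p.injective (Subtype.ext (sub_eq_zero.1 h))
  · exact Polynomial.mem_degreeLT.1 (Submodule.sub_mem _ (p k).2 (p l).2)

theorem AreEigenbases.sameBasis_one {p : Fin (2 ^ m) → (ZMod 2)[X]}
    {𝔅 : Fin (2 ^ m + 1) → Matrix (Fin m → ZMod 2) (Fin m → ZMod 2) ℂ}
    (h : AreEigenbases B p 𝔅) : SameBasis 1 (𝔅 0) :=
  one_isSeparatingEigenbasis.sameBasis (h 0)

theorem AreEigenbases.sameBasis_quadBasis (hB : B.IsSymm) {p : Fin (2 ^ m) → (ZMod 2)[X]}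
    {𝔅 : Fin (2 ^ m + 1) → Matrix (Fin m → ZMod 2) (Fin m → ZMod 2) ℂ}
    (h : AreEigenbases B p 𝔅) (k : Fin (2 ^ m)) :
    SameBasis (quadBasis (natLift (Polynomial.aeval B (p k)))) (𝔅 k.succ) := by
  refine (quadBasis_isSeparatingEigenbasis (natLift_isSymm (aeval_isSymm hB _))).sameBasis ?_
  rw [natLift_map_natCast]
  exact h k.succ

theorem exists_areEigenbases (hB : B.IsSymm) (p : Fin (2 ^ m) → (ZMod 2)[X]) :
    ∃ 𝔅, AreEigenbases B p 𝔅 := by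
  refine ⟨Fin.cons 1 fun k => quadBasis (natLift (Polynomial.aeval B (p k))), fun k => ?_⟩
  cases k using Fin.cases with
  | zero => exact one_isSeparatingEigenbasis.1
  | succ k =>
    have := (quadBasis_isSeparatingEigenbasis (natLift_isSymm (aeval_isSymm hB (p k)))).1
    rwa [natLift_map_natCast] at this

theorem AreEigenbases.isCompleteMUB (hB : B.IsSymm) (hirr : Irreducible B.charpoly)
    {𝔅 : Fin (2 ^ m + 1) → Matrix (Fin m → ZMod 2) (Fin m → ZMod 2) ℂ}
    (h : AreEigenbases B (fun k => (p k : (ZMod 2)[X])) 𝔅) : IsCompleteMUB 𝔅 := by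
  refine ⟨by simp [ZMod.card], fun k => (h k).1, fun k l hkl => ?_⟩
  have h0 : ∀ k : Fin (2 ^ m), MutuallyUnbiased (𝔅 0) (𝔅 k.succ) := fun k =>
    (mutuallyUnbiased_one_quadBasis _).of_sameBasis h.sameBasis_one (h.sameBasis_quadBasis hB k)
  cases k using Fin.cases with
  | zero =>
    cases l using Fin.cases with
    | zero => exact absurd rfl hkl
    | succ l => exact h0 l
  | succ k =>
    cases l using Fin.cases with
    | zero => exact (h0 k).symm
    | succ l =>
      refine MutuallyUnbiased.of_sameBasis ?_ (h.sameBasis_quadBasis hB k)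
        (h.sameBasis_quadBasis hB l)
      refine mutuallyUnbiased_quadBasis (natLift_isSymm (aeval_isSymm hB _))
        (natLift_isSymm (aeval_isSymm hB _)) ?_
      rw [natLift_map_natCast, natLift_map_natCast]
      exact isUnit_aeval_sub hirr p fun e => hkl (congrArg Fin.succ e.symm)

/-- Let `φ` identify `K` with the field generated by `B`, and fix `v ≠ 0`. The relabelling
`l ↦ φ (∑ l_a f_a) v` turns the form of `φ s` into `(x, y) ↦ Λ_s (x y)` with the linear functional
`Λ_s x = v ⬝ φ (s x) v`. As `s` runs through `K`, `Λ_s` runs through all linear functionals, and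
the forms of these are the Wootters–Fields ones. -/
theorem AreEigenbases.equivalentBases_woottersFields (hB : B.IsSymm)
    (hirr : Irreducible B.charpoly)
    {𝔅 : Fin (2 ^ m + 1) → Matrix (Fin m → ZMod 2) (Fin m → ZMod 2) ℂ}
    (h : AreEigenbases B (fun k => (p k : (ZMod 2)[X])) 𝔅) {K : Type*} [Field K]
    [Algebra (ZMod 2) K] (f : Module.Basis (Fin m) (ZMod 2) K)
    (e : Fin (2 ^ m) ≃ (Fin m → ZMod 2)) : EquivalentBases 𝔅 (woottersFields f e) := by
  obtain ⟨φ, hφ⟩ := exists_algHom_range_eq hirr K f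
  have hsymm : ∀ x, (φ x).transpose = φ x := by
    intro x
    obtain ⟨q, hq⟩ : φ x ∈ (Polynomial.aeval B).range := by rw [← hφ]; exact ⟨x, rfl⟩
    rw [← hq]
    exact aeval_isSymm hB q
  have hs : ∀ k, ∃ s, φ s = Polynomial.aeval B (p k : (ZMod 2)[X]) := by
    intro k
    have : Polynomial.aeval B (p k : (ZMod 2)[X]) ∈ φ.range := by rw [hφ]; exact ⟨_, rfl⟩
    exact this
  choose s hs using hs
  let v : Fin m → ZMod 2 := Pi.single ⟨0, pos_of_irreducible_charpoly hirr⟩ 1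
  have hv : v ≠ 0 := by simp [v]
  let E₀ : (Fin m → ZMod 2) →+ (Fin m → ZMod 2) :=
    { toFun := fun l => (φ (f.equivFun.symm l)).mulVec v
      map_zero' := by simp
      map_add' := fun x y => by rw [map_add, map_add, Matrix.add_mulVec] }
  have hE₀ : Function.Injective E₀ := by
    rw [injective_iff_map_eq_zero]
    intro l hl
    by_contra hne
    have hx : f.equivFun.symm l ≠ 0 := f.equivFun.symm.map_ne_zero_iff.2 hne
    apply hv
    calc v = (φ ((f.equivFun.symm l)⁻¹ * f.equivFun.symm l)).mulVec v := by
          rw [inv_mul_cancel₀ hx, map_one, Matrix.one_mulVec]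
      _ = 0 := by
          rw [map_mul, ← Matrix.mulVec_mulVec]
          exact (congrArg _ hl).trans (Matrix.mulVec_zero _)
  let E : (Fin m → ZMod 2) ≃+ (Fin m → ZMod 2) :=
    AddEquiv.ofBijective E₀ hE₀.bijective_of_finite
  let Λ : K → K →ₗ[ZMod 2] ZMod 2 := fun t =>
    { toFun := fun x => v ⬝ᵥ (φ (t * x)).mulVec v
      map_add' := fun x y => by rw [mul_add, map_add, Matrix.add_mulVec, dotProduct_add]
      map_smul' := fun a x => by
        rw [mul_smul_comm, map_smul, Matrix.smul_mulVec, dotProduct_smul, RingHom.id_apply] }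
  have hform : ∀ t l c, E l ⬝ᵥ (φ t).mulVec (E c) =
      Λ t (f.equivFun.symm l * f.equivFun.symm c) := by
    intro t l c
    change (φ (f.equivFun.symm l)).mulVec v ⬝ᵥ (φ t).mulVec ((φ (f.equivFun.symm c)).mulVec v) =
      v ⬝ᵥ (φ (t * (f.equivFun.symm l * f.equivFun.symm c))).mulVec v
    rw [← Matrix.vecMul_transpose, hsymm, ← Matrix.dotProduct_mulVec, Matrix.mulVec_mulVec,
      Matrix.mulVec_mulVec, ← map_mul, ← map_mul, mul_left_comm, mul_assoc]
  have hΛ : Function.Injective Λ := by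
    intro t t' htt
    by_contra hne
    apply hv
    refine dotProduct_eq_zero v fun w => ?_
    obtain ⟨l, rfl⟩ := E.surjective w
    have := LinearMap.congr_fun htt ((t - t')⁻¹ * f.equivFun.symm l)
    rw [← sub_eq_zero] at this
    change v ⬝ᵥ (φ (t * _)).mulVec v - v ⬝ᵥ (φ (t' * _)).mulVec v = 0 at this
    rwa [← dotProduct_sub, ← Matrix.sub_mulVec, ← map_sub, ← sub_mul,
      mul_inv_cancel_left₀ (sub_ne_zero.2 hne)] at this
  -- `ρ k` is the label of the Wootters–Fields basis corresponding to the class of `p k`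
  let ρ₀ : Fin (2 ^ m) → Fin m → ZMod 2 := fun k a => Λ (s k) (f a)
  have hρ₀ : Function.Injective ρ₀ := by
    intro k l hkl
    by_contra hne
    have hst : s k = s l := hΛ (f.ext fun a => congrFun hkl a)
    have hu := isUnit_aeval_sub hirr p hne
    rw [← hs, ← hs, hst, sub_self] at hu
    have : Nonempty (Fin m) := ⟨⟨0, pos_of_irreducible_charpoly hirr⟩⟩
    exact not_isUnit_zero hu
  let ρ : Fin (2 ^ m) ≃ (Fin m → ZMod 2) := Equiv.ofBijective ρ₀
    ((Fintype.bijective_iff_injective_and_card _).2 ⟨hρ₀, by simp [ZMod.card]⟩)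
  let τ : Equiv.Perm (Fin (2 ^ m)) := e.trans ρ.symm
  -- the permutation of the indices fixes `0`, the index of the standard basis
  refine equivalentBases_of_sameBasis (U := Equiv.Perm.permMatrix ℂ E.toEquiv)
    (isMonomial_permMatrix _).mem_unitaryGroup
    (Equiv.Perm.decomposeFin.symm (0, τ)) fun k => ?_
  cases k using Fin.cases with
  | zero =>
    rw [Equiv.Perm.decomposeFin_symm_apply_zero]
    have h1 := h.sameBasis_one.mul_left (Equiv.Perm.permMatrix ℂ E.toEquiv)
    rw [Matrix.mul_one] at h1
    have h2 : SameBasis 1 (Equiv.Perm.permMatrix ℂ E.toEquiv) :=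
      ⟨_, isMonomial_permMatrix _, (Matrix.one_mul _).symm⟩
    exact (h2.trans h1).symm
  | succ k =>
    rw [Equiv.Perm.decomposeFin_symm_apply_succ, Equiv.swap_self, Equiv.refl_apply]
    refine ((h.sameBasis_quadBasis hB (τ k)).mul_left _).symm.trans ?_
    have hk : woottersFields f e k.succ =
        quadBasis (woottersFieldsForm f fun a => Λ (s (τ k)) (f a)) := by
      have : ρ (τ k) = e k := ρ.apply_symm_apply (e k)
      exact (woottersFieldsBasis_eq_quadBasis f (e k)).trans (by rw [← this]; rfl)
    rw [hk]
    refine sameBasis_permMatrix_mul_quadBasis (natLift_isSymm (aeval_isSymm hB _))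
      (woottersFieldsForm_isSymm f _) E fun l c => ?_
    rw [natLift_map_natCast, ← hs, hform, dotProduct_woottersFieldsForm_mulVec]

end Equivalence

theorem mainTheorem4 (m : ℕ) (B : Matrix (Fin m) (Fin m) (ZMod 2)) (hB : B.IsSymm)
    (hirr : Irreducible B.charpoly)
    (p : Fin (2 ^ m) ≃ Polynomial.degreeLT (ZMod 2) m) :
    (∃ 𝔅, AreEigenbases B (fun k => (p k : Polynomial (ZMod 2))) 𝔅) ∧
    ∀ 𝔅 : Fin (2 ^ m + 1) → Matrix (Fin m → ZMod 2) (Fin m → ZMod 2) ℂ,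
      AreEigenbases B (fun k => (p k : Polynomial (ZMod 2))) 𝔅 →
      IsCompleteMUB 𝔅 ∧
      (∀ (B' : Matrix (Fin m) (Fin m) (ZMod 2)), B'.IsSymm → Irreducible B'.charpoly →
        ∀ (p' : Fin (2 ^ m) ≃ Polynomial.degreeLT (ZMod 2) m)
          (𝔅' : Fin (2 ^ m + 1) → Matrix (Fin m → ZMod 2) (Fin m → ZMod 2) ℂ),
          AreEigenbases B' (fun k => (p' k : Polynomial (ZMod 2))) 𝔅' →
          EquivalentBases 𝔅 𝔅') ∧
      (∀ (K : Type*) [Field K] [Algebra (ZMod 2) K] (f : Module.Basis (Fin m) (ZMod 2) K)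
        (e : Fin (2 ^ m) ≃ (Fin m → ZMod 2)),
        EquivalentBases 𝔅 (woottersFields f e)) := by
  refine ⟨exists_areEigenbases hB _, fun 𝔅 h => ⟨h.isCompleteMUB hB hirr, ?_, ?_⟩⟩
  · intro B' hB' hirr' p' 𝔅' h'
    let f : Module.Basis (Fin m) (ZMod 2) (GaloisField 2 m) := Module.finBasisOfFinrankEq _ _
      (GaloisField.finrank 2 (pos_of_irreducible_charpoly hirr).ne')
    let e : Fin (2 ^ m) ≃ (Fin m → ZMod 2) := Fintype.equivOfCardEq (by simp [ZMod.card])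
    exact (h.equivalentBases_woottersFields hB hirr f e).trans
      (h'.equivalentBases_woottersFields hB' hirr' f e).symm
  · intro K _ _ f e
    exact h.equivalentBases_woottersFields hB hirr f e
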